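/- Let $n\ge 2$ and let $(M,h)$ be a nonempty $n$-dimensional smooth Riemannian manifold (without boundary). Suppose that one of the following holds: 1. $M$ is compact, $n$ is even, and all sectional curvatures of $h$ are positive; 2. the Ricci tensor of $h$ is negative definite at every point, i.e. $\mathrm{Ric}(v,v)<0$ for every nonzero tangent vector $v$; 3. $n=2$ and the sectional curvature of $h$ is negative at some point; 4. $n\ge 3$ and $h$ has constant sectional curvature $c$ for some $c<0$. Then $(M,h)$ admits no globally defined unit Killing field, that is, there is no smooth vector field $W$ on $M$ with $h(W,W)=1$ everywhere and $h(\nabla_u W,v)+h(\nabla_v W,u)=0$ for all tangent vectors $u,v$ at the same point, where $\nabla$ is the Levi-Civita connection of $h$. Consequently $(M,h)$ admits no globally defined UK-Kropina metric, that is, there is no function $F=\alpha^2/\beta$ on the domain $\{(x,y)\in TM:\beta_x(y)>0\}$ with $\alpha^2(x,y)=e^{-k(x)}h_x(y,y)$ and $\beta_x(y)=2e^{-k(x)}h_x(W_x,y)$, where $k$ is a smooth function on $M$ and $W$ is a globally defined unit Killing field of $(M,h)$. -/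

import Mathlib

open scoped Manifold ContDiff

noncomputable section

namespace Kropina

/-! ### Local formulas

`V` is a finite dimensional coordinate space, and `G : V → V →L[ℝ] V →L[ℝ] ℝ` is a metric tensor in
coordinates: `G y u v = g_{ij}(y) u^i v^j`. -/

section Coordinates

variable {V : Type*} [NormedAddCommGroup V] [NormedSpace ℝ V]

/-- Christoffel symbols of the first kind: the covector
`w ↦ (1/2) (∂_u g(v, w) + ∂_v g(u, w) - ∂_w g(u, v))`, where `u`, `v`, `w` are constant
coordinate fields. -/
def christoffelFirst (G : V → V →L[ℝ] V →L[ℝ] ℝ) (y u v : V) : V →L[ℝ] ℝ :=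
  (1 / 2 : ℝ) • (fderiv ℝ G y u v + fderiv ℝ G y v u - ((fderiv ℝ G y).flip u).flip v)

/-- Christoffel symbols of the second kind, `Γ(u, v)^i = Γ^i_{jk} u^j v^k`: the index is raised
with the inverse of the map `V → V*` given by the metric. -/
def christoffel (G : V → V →L[ℝ] V →L[ℝ] ℝ) (y u v : V) : V :=
  (G y).inverse (christoffelFirst G y u v)

/-- Levi-Civita covariant derivative `∇_u X = ∂_u X + Γ(u, X)` in coordinates. -/
def covDeriv (G : V → V →L[ℝ] V →L[ℝ] ℝ) (X : V → V) (y u : V) : V :=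
  fderiv ℝ X y u + christoffel G y u (X y)

/-- Curvature `R(u, v) w = ∇_u ∇_v w - ∇_v ∇_u w` in coordinates, where `u`, `v`, `w` are constant
coordinate fields (so that their brackets vanish). -/
def curvature (G : V → V →L[ℝ] V →L[ℝ] ℝ) (y u v w : V) : V :=
  covDeriv G (fun z ↦ christoffel G z v w) y u - covDeriv G (fun z ↦ christoffel G z u w) y v

end Coordinates

/-! ### Riemannian manifolds -/

section Manifold

variable {n : ℕ} {M : Type*} [TopologicalSpace M] [ChartedSpace (EuclideanSpace ℝ (Fin n)) M]
  [IsManifold (𝓡 n) ∞ M]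

/-- Smooth Riemannian metrics on the `n`-dimensional smooth manifold `M`. -/
abbrev RiemMetric (n : ℕ) (M : Type*) [TopologicalSpace M]
    [ChartedSpace (EuclideanSpace ℝ (Fin n)) M] [IsManifold (𝓡 n) ∞ M] :=
  Bundle.ContMDiffRiemannianMetric (𝓡 n) ∞ (EuclideanSpace ℝ (Fin n))
    (fun x : M ↦ TangentSpace (𝓡 n) x)

/-- The differential at `x` of the chart around `x₀`. -/
def toCoord (x₀ x : M) : TangentSpace (𝓡 n) x →L[ℝ] EuclideanSpace ℝ (Fin n) :=
  mfderiv (𝓡 n) 𝓘(ℝ, EuclideanSpace ℝ (Fin n)) (extChartAt (𝓡 n) x₀) x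

/-- The differential at `y` of the inverse of the chart around `x₀`. -/
def ofCoord (x₀ : M) (y : EuclideanSpace ℝ (Fin n)) :
    EuclideanSpace ℝ (Fin n) →L[ℝ] TangentSpace (𝓡 n) ((extChartAt (𝓡 n) x₀).symm y) :=
  mfderiv 𝓘(ℝ, EuclideanSpace ℝ (Fin n)) (𝓡 n) (extChartAt (𝓡 n) x₀).symm y

/-- The metric `h` in the chart around `x₀`. -/
def coordMetric (h : RiemMetric n M) (x₀ : M) (y : EuclideanSpace ℝ (Fin n)) :
    EuclideanSpace ℝ (Fin n) →L[ℝ] EuclideanSpace ℝ (Fin n) →L[ℝ] ℝ :=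
  ContinuousLinearMap.precomp ℝ (ofCoord x₀ y) ∘L
    (h.inner ((extChartAt (𝓡 n) x₀).symm y) ∘L ofCoord x₀ y)

theorem coordMetric_apply (h : RiemMetric n M) (x₀ : M) (y u v : EuclideanSpace ℝ (Fin n)) :
    coordMetric h x₀ y u v =
      h.inner ((extChartAt (𝓡 n) x₀).symm y) (ofCoord x₀ y u) (ofCoord x₀ y v) := rfl

/-- The vector field `W` in the chart around `x₀`. -/
def coordField (W : ∀ x : M, TangentSpace (𝓡 n) x) (x₀ : M) (y : EuclideanSpace ℝ (Fin n)) :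
    EuclideanSpace ℝ (Fin n) :=
  toCoord x₀ ((extChartAt (𝓡 n) x₀).symm y) (W ((extChartAt (𝓡 n) x₀).symm y))

/-- The curvature tensor of `h` at `x`, with components `R(u, v) w` in the chart around `x`. -/
def coordCurvature (h : RiemMetric n M) (x : M) (u v w : TangentSpace (𝓡 n) x) :
    EuclideanSpace ℝ (Fin n) :=
  curvature (coordMetric h x) (extChartAt (𝓡 n) x x)
    (toCoord x x u) (toCoord x x v) (toCoord x x w)

/-- Sectional curvature `h(R(u, v) v, u) / (h(u, u) h(v, v) - h(u, v)^2)` of the plane spanned by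
the linearly independent tangent vectors `u`, `v`. -/
def sectionalCurvature (h : RiemMetric n M) (x : M) (u v : TangentSpace (𝓡 n) x) : ℝ :=
  coordMetric h x (extChartAt (𝓡 n) x x) (coordCurvature h x u v v) (toCoord x x u) /
    (h.inner x u u * h.inner x v v - h.inner x u v ^ 2)

/-- Ricci tensor `Ric(v, w)`: the trace of `u ↦ R(u, v) w`, computed in the coordinate basis of the
chart around `x`. -/
def ricci (h : RiemMetric n M) (x : M) (v w : TangentSpace (𝓡 n) x) : ℝ :=
  ∑ i : Fin n, curvature (coordMetric h x) (extChartAt (𝓡 n) x x)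
    (EuclideanSpace.single i 1) (toCoord x x v) (toCoord x x w) i

/-- `W` is a Killing vector field: it is smooth, and in every chart
`h(∇_u W, v) + h(∇_v W, u) = 0`, i.e. `W_{i||j} + W_{j||i} = 0`. -/
structure IsKilling (h : RiemMetric n M) (W : ∀ x : M, TangentSpace (𝓡 n) x) : Prop where
  smooth : ContMDiff (𝓡 n) (𝓡 n).tangent ∞
    (fun x ↦ (⟨x, W x⟩ : TangentBundle (𝓡 n) M))
  killing : ∀ x₀ : M, ∀ y ∈ (extChartAt (𝓡 n) x₀).target, ∀ u v : EuclideanSpace ℝ (Fin n),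
    coordMetric h x₀ y (covDeriv (coordMetric h x₀) (coordField W x₀) y u) v +
      coordMetric h x₀ y (covDeriv (coordMetric h x₀) (coordField W x₀) y v) u = 0

/-- `W` is a Killing vector field of length one everywhere. -/
structure IsUnitKilling (h : RiemMetric n M) (W : ∀ x : M, TangentSpace (𝓡 n) x) : Prop
    extends IsKilling h W where
  unit : ∀ x, h.inner x (W x) (W x) = 1

/-- `h` has positive sectional curvature. -/
def PosSectional (h : RiemMetric n M) : Prop :=
  ∀ (x : M) (u v : TangentSpace (𝓡 n) x), LinearIndependent ℝ ![u, v] →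
    0 < sectionalCurvature h x u v

/-- `h` has negative definite Ricci tensor. -/
def NegRicci (h : RiemMetric n M) : Prop :=
  ∀ (x : M) (v : TangentSpace (𝓡 n) x), v ≠ 0 → ricci h x v v < 0

/-- Some plane at some point has negative sectional curvature. -/
def NegSectionalSomewhere (h : RiemMetric n M) : Prop :=
  ∃ (x : M) (u v : TangentSpace (𝓡 n) x), LinearIndependent ℝ ![u, v] ∧
    sectionalCurvature h x u v < 0

/-- All planes at all points have sectional curvature `c`. -/
def ConstSectional (h : RiemMetric n M) (c : ℝ) : Prop :=
  ∀ (x : M) (u v : TangentSpace (𝓡 n) x), LinearIndependent ℝ ![u, v] →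
    sectionalCurvature h x u v = c

/-! ### Kropina metrics -/

/-- The conformal metric `e^{-k} h`. -/
def conformal (h : RiemMetric n M) (k : C^∞⟮𝓡 n, M; ℝ⟯) : RiemMetric n M where
  inner x := Real.exp (-k x) • h.inner x
  symm x v w := by simp [h.symm x v w]
  pos x v hv := by
    have := h.pos x v hv
    exact mul_pos (Real.exp_pos _) this
  isVonNBounded x := by
    have hb := (h.isVonNBounded x).image
      (Real.exp (k x / 2) • ContinuousLinearMap.id ℝ (TangentSpace (𝓡 n) x))
    refine hb.subset ?_
    intro v hv
    refine ⟨Real.exp (-(k x / 2)) • v, ?_, ?_⟩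
    · have e : Real.exp (-k x) = Real.exp (-(k x / 2)) * Real.exp (-(k x / 2)) := by
        rw [← Real.exp_add]
        ring_nf
      have hv' : Real.exp (-k x) * h.inner x v v < 1 := hv
      rw [e, mul_assoc] at hv'
      simpa using hv'
    · change Real.exp (k x / 2) • Real.exp (-(k x / 2)) • v = v
      rw [smul_smul, ← Real.exp_add]
      simp
  contMDiff := by
    have hk : ContMDiff (𝓡 n) 𝓘(ℝ) ∞ (fun x : M ↦ Real.exp (-k x)) :=
      Real.contDiff_exp.contMDiff.comp k.contMDiff.neg
    intro x
    have hx := h.contMDiff x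
    rw [Bundle.contMDiffAt_section] at hx ⊢
    convert! (hk x).smul hx using 2
    ext v w
    simp [hom_trivializationAt_apply, ContinuousLinearMap.inCoordinates]

/-- The one-form `β = 2 e^{-k} h(W, ·)`. -/
def navForm (h : RiemMetric n M) (W : ∀ x : M, TangentSpace (𝓡 n) x) (k : C^∞⟮𝓡 n, M; ℝ⟯)
    (x : M) : TangentSpace (𝓡 n) x →L[ℝ] ℝ :=
  (2 * Real.exp (-k x)) • h.inner x (W x)

/-- `F`, defined on the subset `A` of the tangent bundle, is the Kropina metric `α^2 / β`, where
`α^2 = a(y, y)` for the Riemannian metric `a`, and `β` is a one-form: its domain is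
`{(x, y) | β_x(y) > 0}`. -/
def IsKropina (a : RiemMetric n M) (β : ∀ x : M, TangentSpace (𝓡 n) x →L[ℝ] ℝ)
    (A : Set (TangentBundle (𝓡 n) M)) (F : A → ℝ) : Prop :=
  A = {p | 0 < β p.1 p.2} ∧ ∀ p : A, F p = a.inner p.1.1 p.1.2 p.1.2 / β p.1.1 p.1.2

/-- `F` is a UK-Kropina metric on `(M, h)`: the Kropina metric `α^2 / β` given by `a = e^{-k} h`
and `β = 2 e^{-k} h(W, ·)`, for a unit Killing vector field `W` of `h` defined on the whole of `M`
and a smooth function `k`. -/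
def IsUKKropina (h : RiemMetric n M) (A : Set (TangentBundle (𝓡 n) M)) (F : A → ℝ) : Prop :=
  ∃ (W : ∀ x : M, TangentSpace (𝓡 n) x) (k : C^∞⟮𝓡 n, M; ℝ⟯), IsUnitKilling h W ∧
    IsKropina (conformal h k) (navForm h W k) A F

end Manifold

end Kropina

end

/-!
If `W` is a unit Killing field, then `A u = ∇_u W` is skew-adjoint and takes values in the orthogonal
complement of `W`, because `2 h(∇_u W, W) = u (h(W, W)) = 0`; hence also `A W = 0`. Differentiating
the Killing equation and the relation `h(∇_u W, W) = 0` once more gives the identity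

  `h(R(u, W) W, u) = |∇_u W|²`,

which is `IsLocalUnitKilling.apply_curvature`. All planes containing `W` therefore have nonnegative
sectional curvature, and taking the trace, `Ric(W, W) ≥ 0`. This rules out a negative definite Ricci
tensor and constant negative curvature. In dimension two every plane contains `W`, so no sectional
curvature is negative. If the dimension is even, then `A` acts skew-adjointly on the odd-dimensional
orthogonal complement of `W`, so it has a kernel there, and the plane spanned by `W` and a vector of
this kernel is flat; this excludes positive sectional curvature.

Every one of these conclusions concerns a single point, so the Riemannian geometry takes place on an
open set `U` of a coordinate space (`IsLocalMetric`, `IsLocalUnitKilling`). The charts of the manifold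
supply such data (`isLocalMetric_coordMetric`, `IsUnitKilling.isLocalUnitKilling`).
-/

set_option maxSynthPendingDepth 3

namespace Kropina

/-! ### Metrics on open sets of a coordinate space -/

section LocalGeometry

theorem two_le_infty : (2 : WithTop ℕ∞) ≤ ∞ := WithTop.coe_le_coe.2 le_top

theorem one_add_one_le_infty : (1 + 1 : WithTop ℕ∞) ≤ ∞ := by
  rw [one_add_one_eq_two]; exact two_le_infty

variable {V : Type*} [NormedAddCommGroup V] [NormedSpace ℝ V]

/-- `G` restricts to a smooth Riemannian metric on the open set `U`. -/
structure IsLocalMetric (G : V → V →L[ℝ] V →L[ℝ] ℝ) (U : Set V) : Prop where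
  isOpen : IsOpen U
  smooth : ContDiffOn ℝ ∞ G U
  symm : ∀ y ∈ U, ∀ u v, G y u v = G y v u
  pos : ∀ y ∈ U, ∀ u, u ≠ 0 → 0 < G y u u

/-- `X` is a smooth unit Killing field of `G` on `U`. -/
structure IsLocalUnitKilling (G : V → V →L[ℝ] V →L[ℝ] ℝ) (X : V → V) (U : Set V) : Prop where
  smooth : ContDiffOn ℝ ∞ X U
  killing : ∀ y ∈ U, ∀ u v, G y (covDeriv G X y u) v + G y (covDeriv G X y v) u = 0
  unit : ∀ y ∈ U, G y (X y) (X y) = 1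

/-- The Christoffel symbols of the second kind as a field of bilinear maps, so that they can be
differentiated. -/
noncomputable def christoffelBilin (G : V → V →L[ℝ] V →L[ℝ] ℝ) (y : V) : V →L[ℝ] V →L[ℝ] V :=
  (ContinuousLinearMap.compL ℝ V (V →L[ℝ] ℝ) V (G y).inverse) ∘L
    ((1 / 2 : ℝ) • (fderiv ℝ G y + (fderiv ℝ G y).flip -
      (ContinuousLinearMap.flipₗᵢ ℝ V V ℝ).toContinuousLinearEquiv.toContinuousLinearMap ∘L
        (fderiv ℝ G y).flip))

theorem christoffelBilin_apply (G : V → V →L[ℝ] V →L[ℝ] ℝ) (y u v : V) :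
    christoffelBilin G y u v = christoffel G y u v := rfl

theorem covDeriv_eq (G : V → V →L[ℝ] V →L[ℝ] ℝ) (X : V → V) (y u : V) :
    covDeriv G X y u = fderiv ℝ X y u + christoffelBilin G y u (X y) := rfl

theorem covDeriv_add_right (G : V → V →L[ℝ] V →L[ℝ] ℝ) (X : V → V) (y u v : V) :
    covDeriv G X y (u + v) = covDeriv G X y u + covDeriv G X y v := by
  simp only [covDeriv_eq, map_add, add_apply]
  abel

theorem covDeriv_smul_right (G : V → V →L[ℝ] V →L[ℝ] ℝ) (X : V → V) (y : V) (a : ℝ) (u : V) :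
    covDeriv G X y (a • u) = a • covDeriv G X y u := by
  simp only [covDeriv_eq, map_smul, smul_apply, smul_add]

/-- The endomorphism `u ↦ ∇_u X` of the tangent space. -/
noncomputable def covDerivLinear (G : V → V →L[ℝ] V →L[ℝ] ℝ) (X : V → V) (y : V) : V →ₗ[ℝ] V where
  toFun := covDeriv G X y
  map_add' := covDeriv_add_right G X y
  map_smul' := covDeriv_smul_right G X y

theorem covDeriv_const (G : V → V →L[ℝ] V →L[ℝ] ℝ) (w z v : V) :
    covDeriv G (fun _ ↦ w) z v = christoffel G z v w := by
  simp [covDeriv]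

theorem curvature_swap (G : V → V →L[ℝ] V →L[ℝ] ℝ) (y u v w : V) :
    curvature G y u v w = -curvature G y v u w := by
  simp [curvature]

namespace IsLocalMetric

variable {G : V → V →L[ℝ] V →L[ℝ] ℝ} {U : Set V} {y : V}

theorem contDiffAt (hG : IsLocalMetric G U) (hy : y ∈ U) : ContDiffAt ℝ ∞ G y :=
  hG.smooth.contDiffAt (hG.isOpen.mem_nhds hy)

theorem differentiableAt (hG : IsLocalMetric G U) (hy : y ∈ U) : DifferentiableAt ℝ G y :=
  (hG.contDiffAt hy).differentiableAt (by simp)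

theorem nonneg (hG : IsLocalMetric G U) (hy : y ∈ U) (u : V) : 0 ≤ G y u u := by
  by_cases hu : u = 0
  · simp [hu]
  · exact (hG.pos y hy u hu).le

/-- The Cauchy-Schwarz inequality. -/
theorem cauchy_schwarz (hG : IsLocalMetric G U) (hy : y ∈ U) (u v : V) :
    0 ≤ G y u u * G y v v - G y u v ^ 2 := by
  by_cases hv : v = 0
  · simp [hv]
  have h1 := hG.pos y hy v hv
  have h2 : 0 ≤ G y (G y v v • u - G y u v • v) (G y v v • u - G y u v • v) :=
    hG.nonneg hy _
  have h3 : G y (G y v v • u - G y u v • v) (G y v v • u - G y u v • v)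
      = G y v v * (G y u u * G y v v - G y u v ^ 2) := by
    simp only [map_sub, map_smul, sub_apply, smul_apply,
      smul_eq_mul, hG.symm y hy v u]
    ring
  rw [h3] at h2
  exact nonneg_of_mul_nonneg_right h2 h1

/-- Symmetry of the metric, differentiated. -/
theorem fderiv_symm (hG : IsLocalMetric G U) (hy : y ∈ U) (w u v : V) :
    fderiv ℝ G y w u v = fderiv ℝ G y w v u := by
  have key : ∀ a b : V, HasFDerivAt (fun z ↦ G z a b)
      (((fderiv ℝ G y).flip a).flip b) y := fun a b ↦ by
    have h1 := ((hG.differentiableAt hy).hasFDerivAt.clm_apply (hasFDerivAt_const a y)).clm_apply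
      (hasFDerivAt_const b y)
    have h2 : (G y a ∘L (0 : V →L[ℝ] V) + (G y ∘L (0 : V →L[ℝ] V) + (fderiv ℝ G y).flip a).flip b) =
        ((fderiv ℝ G y).flip a).flip b := by ext; simp
    exact h2 ▸ h1
  have heq : (fun z ↦ G z u v) =ᶠ[nhds y] fun z ↦ G z v u := by
    filter_upwards [hG.isOpen.mem_nhds hy] with z hz using hG.symm z hz u v
  exact congrArg (fun f : V →L[ℝ] ℝ ↦ f w)
    ((key u v).unique ((key v u).congr_of_eventuallyEq heq))

/-- The Levi-Civita connection has no torsion. -/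
theorem christoffelBilin_symm (hG : IsLocalMetric G U) (hy : y ∈ U) (u v : V) :
    christoffelBilin G y u v = christoffelBilin G y v u := by
  simp only [christoffelBilin_apply, christoffel]
  congr 1
  ext w
  simp only [christoffelFirst, smul_apply, sub_apply,
    add_apply, ContinuousLinearMap.flip_apply, hG.fderiv_symm hy w u v]
  ring

variable [FiniteDimensional ℝ V]

theorem isInvertible (hG : IsLocalMetric G U) (hy : y ∈ U) : (G y).IsInvertible := by
  have hinj : Function.Injective (G y : V →ₗ[ℝ] V →L[ℝ] ℝ) := by
    rw [injective_iff_map_eq_zero]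
    intro a ha
    by_contra hne
    have h1 := hG.pos y hy a hne
    have h2 : G y a = 0 := ha
    simp [h2] at h1
  have hdim : Module.finrank ℝ V = Module.finrank ℝ (V →L[ℝ] ℝ) := by
    rw [← (LinearMap.toContinuousLinearMap (𝕜 := ℝ) (E := V) (F' := ℝ)).finrank_eq]
    exact Subspace.dual_finrank_eq.symm
  refine ⟨(LinearEquiv.ofInjectiveOfFinrankEq (G y : V →ₗ[ℝ] V →L[ℝ] ℝ) hinj
    hdim).toContinuousLinearEquiv, ?_⟩
  ext; rfl

theorem contDiffAt_christoffelBilin (hG : IsLocalMetric G U) (hy : y ∈ U) :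
    ContDiffAt ℝ ∞ (christoffelBilin G) y := by
  have h1 : ContDiffAt ℝ ∞ (fun z ↦ (G z).inverse) y :=
    (hG.isInvertible hy).contDiffAt_map_inverse.comp y (hG.contDiffAt hy)
  have h2 : ContDiffAt ℝ ∞ (fderiv ℝ G) y :=
    (hG.contDiffAt hy).fderiv_right (by simp)
  have h3 : ContDiffAt ℝ ∞ (fun z ↦ (fderiv ℝ G z).flip) y :=
    ((ContinuousLinearMap.flipₗᵢ ℝ V V
      (V →L[ℝ] ℝ)).toContinuousLinearEquiv.contDiff.contDiffAt).comp y h2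
  unfold christoffelBilin
  refine ContDiffAt.clm_comp ?_ ?_
  · exact (ContinuousLinearMap.contDiff _).contDiffAt.comp y h1
  · exact ((h2.add h3).sub (contDiffAt_const.clm_comp h3)).const_smul _

theorem differentiableAt_christoffelBilin (hG : IsLocalMetric G U) (hy : y ∈ U) :
    DifferentiableAt ℝ (christoffelBilin G) y :=
  (hG.contDiffAt_christoffelBilin hy).differentiableAt (by simp)

theorem apply_christoffelBilin (hG : IsLocalMetric G U) (hy : y ∈ U) (u v w : V) :
    G y (christoffelBilin G y u v) w =
      1 / 2 * (fderiv ℝ G y u v w + fderiv ℝ G y v u w - fderiv ℝ G y w u v) := by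
  rw [christoffelBilin_apply, christoffel, (hG.isInvertible hy).self_apply_inverse]
  simp [christoffelFirst]

/-- The Levi-Civita connection is compatible with the metric. -/
theorem fderiv_apply (hG : IsLocalMetric G U) (hy : y ∈ U) (w u v : V) :
    fderiv ℝ G y w u v =
      G y (christoffelBilin G y w u) v + G y u (christoffelBilin G y w v) := by
  rw [hG.symm y hy u, hG.apply_christoffelBilin hy, hG.apply_christoffelBilin hy,
    hG.fderiv_symm hy w v u]
  ring

/-- Compatibility with the metric, for arbitrary vector fields. -/
theorem fderiv_inner (hG : IsLocalMetric G U) (hy : y ∈ U) {Y Z : V → V}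
    (hY : DifferentiableAt ℝ Y y) (hZ : DifferentiableAt ℝ Z y) (w : V) :
    fderiv ℝ (fun z ↦ G z (Y z) (Z z)) y w =
      G y (covDeriv G Y y w) (Z y) + G y (Y y) (covDeriv G Z y w) := by
  have h1 := ((hG.differentiableAt hy).hasFDerivAt.clm_apply hY.hasFDerivAt).clm_apply
    hZ.hasFDerivAt
  rw [h1.fderiv]
  simp [covDeriv_eq, hG.fderiv_apply hy]
  ring

/-- The commutator of second covariant derivatives of a vector field is the curvature. -/
theorem covDeriv_covDeriv_sub (hG : IsLocalMetric G U) (hy : y ∈ U) {X : V → V}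
    (hX : ContDiffAt ℝ ∞ X y) (u v : V) :
    covDeriv G (fun z ↦ covDeriv G X z v) y u - covDeriv G (fun z ↦ covDeriv G X z u) y v =
      curvature G y u v (X y) := by
  have hsymm : fderiv ℝ (fderiv ℝ X) y u v = fderiv ℝ (fderiv ℝ X) y v u :=
    (hX.isSymmSndFDerivAt (by simpa using two_le_infty)) u v
  have hΓ := (hG.differentiableAt_christoffelBilin hy).hasFDerivAt
  have hX1 : HasFDerivAt X _ y := (hX.differentiableAt (by simp)).hasFDerivAt
  have hX2 : HasFDerivAt (fderiv ℝ X) _ y :=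
    ((hX.fderiv_right (m := 1) one_add_one_le_infty).differentiableAt (by simp)).hasFDerivAt
  have e1 : ∀ a b : V, fderiv ℝ (fun z ↦ covDeriv G X z b) y a =
      fderiv ℝ (fderiv ℝ X) y a b + (fderiv ℝ (christoffelBilin G) y a b (X y) +
        christoffelBilin G y b (fderiv ℝ X y a)) := fun a b ↦ by
    have h := (hX2.clm_apply (hasFDerivAt_const b y)).add
      ((hΓ.clm_apply (hasFDerivAt_const b y)).clm_apply hX1)
    have h' : fderiv ℝ (fun z ↦ covDeriv G X z b) y = _ := h.fderiv
    rw [h']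
    simp [add_comm]
  have e2 : ∀ a b : V, fderiv ℝ (fun z ↦ christoffel G z b (X y)) y a =
      fderiv ℝ (christoffelBilin G) y a b (X y) := fun a b ↦ by
    have h := ((hΓ.clm_apply (hasFDerivAt_const b y)).clm_apply (hasFDerivAt_const (X y) y))
    have h' : fderiv ℝ (fun z ↦ christoffel G z b (X y)) y = _ := h.fderiv
    rw [h']
    simp
  rw [curvature]
  simp only [covDeriv_eq G (fun z ↦ covDeriv G X z _), e1, covDeriv_eq G (fun z ↦ christoffel _ _ _ _),
    e2]
  simp only [covDeriv_eq, christoffelBilin_apply, hsymm, map_add]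
  abel_nf

theorem differentiableAt_christoffel (hG : IsLocalMetric G U) (hy : y ∈ U) (v w : V) :
    DifferentiableAt ℝ (fun z ↦ christoffel G z v w) y :=
  ((hG.differentiableAt_christoffelBilin hy).clm_apply
    (differentiableAt_const v)).clm_apply (differentiableAt_const w)

/-- `R(u, v)` is skew-adjoint. -/
theorem curvature_apply_self (hG : IsLocalMetric G U) (hy : y ∈ U) (u v w : V) :
    G y (curvature G y u v w) w = 0 := by
  have hf : ContDiffAt ℝ ∞ (fun z ↦ G z w w) y :=
    ((hG.contDiffAt hy).clm_apply contDiffAt_const).clm_apply contDiffAt_const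
  have hsymm : fderiv ℝ (fderiv ℝ (fun z ↦ G z w w)) y u v =
    fderiv ℝ (fderiv ℝ (fun z ↦ G z w w)) y v u := (hf.isSymmSndFDerivAt (by simpa using two_le_infty)) u v
  have hd : DifferentiableAt ℝ (fderiv ℝ (fun z ↦ G z w w)) y :=
    (hf.fderiv_right (m := 1) one_add_one_le_infty).differentiableAt (by simp)
  have e : ∀ a b : V, fderiv ℝ (fderiv ℝ (fun z ↦ G z w w)) y a b =
      2 * (G y (covDeriv G (fun z ↦ christoffel G z b w) y a) w +
        G y (christoffel G y b w) (christoffel G y a w)) := fun a b ↦ by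
    have h1 : fderiv ℝ (fun z ↦ fderiv ℝ (fun z ↦ G z w w) z b) y a =
        fderiv ℝ (fderiv ℝ (fun z ↦ G z w w)) y a b := by
      rw [(hd.hasFDerivAt.clm_apply (hasFDerivAt_const b y)).fderiv]; simp
    have h2 : (fun z ↦ fderiv ℝ (fun z ↦ G z w w) z b) =ᶠ[nhds y]
        fun z ↦ (2 : ℝ) • G z (christoffel G z b w) w := by
      filter_upwards [hG.isOpen.mem_nhds hy] with z hz
      rw [hG.fderiv_inner hz (differentiableAt_const w) (differentiableAt_const w),
        covDeriv_const, hG.symm z hz w, smul_eq_mul]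
      ring
    have hdiff : DifferentiableAt ℝ (fun z ↦ G z (christoffel G z b w) w) y :=
      ((hG.differentiableAt hy).clm_apply (hG.differentiableAt_christoffel hy b w)).clm_apply
        (differentiableAt_const w)
    rw [← h1, h2.fderiv_eq, fderiv_fun_const_smul hdiff, smul_apply,
      hG.fderiv_inner hy (hG.differentiableAt_christoffel hy b w) (differentiableAt_const w),
      covDeriv_const, smul_eq_mul]
  rw [e, e, hG.symm y hy (christoffel G y v w)] at hsymm
  simp only [curvature, map_sub, sub_apply]
  linarith

/-- The classical formula for the curvature in terms of the Christoffel symbols; its right-hand side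
is visibly trilinear. -/
theorem curvature_eq (hG : IsLocalMetric G U) (hy : y ∈ U) (u v w : V) :
    curvature G y u v w =
      fderiv ℝ (christoffelBilin G) y u v w
        + christoffelBilin G y u (christoffelBilin G y v w)
        - (fderiv ℝ (christoffelBilin G) y v u w
        + christoffelBilin G y v (christoffelBilin G y u w)) := by
  have e2 : ∀ a b : V, fderiv ℝ (fun z ↦ christoffel G z b w) y a =
      fderiv ℝ (christoffelBilin G) y a b w := fun a b ↦ by
    have h := (((hG.differentiableAt_christoffelBilin hy).hasFDerivAt.clm_apply
      (hasFDerivAt_const b y)).clm_apply (hasFDerivAt_const w y))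
    have h' : fderiv ℝ (fun z ↦ christoffel G z b w) y = _ := h.fderiv
    rw [h']
    simp
  simp only [curvature, covDeriv_eq, e2, christoffelBilin_apply]

end IsLocalMetric

namespace IsLocalUnitKilling

variable {G : V → V →L[ℝ] V →L[ℝ] ℝ} {X : V → V} {U : Set V} {y : V}

theorem contDiffAt (hG : IsLocalMetric G U) (hX : IsLocalUnitKilling G X U) (hy : y ∈ U) :
    ContDiffAt ℝ ∞ X y :=
  hX.smooth.contDiffAt (hG.isOpen.mem_nhds hy)

theorem ne_zero (hX : IsLocalUnitKilling G X U) (hy : y ∈ U) : X y ≠ 0 := fun h ↦ by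
  simpa [h] using hX.unit y hy

variable [FiniteDimensional ℝ V]

theorem apply_covDeriv_self (hG : IsLocalMetric G U) (hX : IsLocalUnitKilling G X U) (hy : y ∈ U)
    (u : V) : G y (covDeriv G X y u) (X y) = 0 := by
  have hd := (contDiffAt hG hX hy).differentiableAt (by simp)
  have h1 := hG.fderiv_inner hy hd hd u
  have h2 : (fun z ↦ G z (X z) (X z)) =ᶠ[nhds y] fun _ ↦ (1 : ℝ) := by
    filter_upwards [hG.isOpen.mem_nhds hy] with z hz using hX.unit z hz
  rw [h2.fderiv_eq, hG.symm y hy (X y)] at h1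
  simp at h1
  linarith

/-- The integral curves of a unit Killing field are geodesics. -/
theorem covDeriv_self (hG : IsLocalMetric G U) (hX : IsLocalUnitKilling G X U) (hy : y ∈ U) :
    covDeriv G X y (X y) = 0 := by
  by_contra hne
  have h1 := hG.pos y hy _ hne
  have h2 := hX.killing y hy (X y) (covDeriv G X y (X y))
  rw [apply_covDeriv_self hG hX hy] at h2
  linarith

/-- `h(R(u, W) W, u) = |∇_u W|²`. By `covDeriv_covDeriv_sub` the left-hand side is the difference
of the second derivatives `∇_u ∇_W W - ∇_W ∇_u W`, with the fields `u` and `W y` frozen; these are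
obtained by differentiating the Killing equation and the relation `h(∇_u W, W) = 0`. -/
theorem apply_curvature (hG : IsLocalMetric G U) (hX : IsLocalUnitKilling G X U) (hy : y ∈ U)
    (u : V) : G y (curvature G y u (X y) (X y)) u =
      G y (covDeriv G X y u) (covDeriv G X y u) := by
  have hdA : ∀ a : V, DifferentiableAt ℝ (fun z ↦ covDeriv G X z a) y := fun a ↦ by
    have hXs := contDiffAt hG hX hy
    have h1 : DifferentiableAt ℝ (fun z ↦ fderiv ℝ X z a) y :=
      ((hXs.fderiv_right (m := 1) one_add_one_le_infty).differentiableAt (by simp)).clm_apply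
        (differentiableAt_const a)
    exact h1.add (((hG.differentiableAt_christoffelBilin hy).clm_apply
      (differentiableAt_const a)).clm_apply (hXs.differentiableAt (by simp)))
  -- The Killing equation for constant fields `a`, `b`, differentiated in the direction `w`.
  have hK : ∀ w a b : V,
      G y (covDeriv G (fun z ↦ covDeriv G X z a) y w) b
        + G y (covDeriv G X y a) (christoffel G y w b)
        + (G y (covDeriv G (fun z ↦ covDeriv G X z b) y w) a
        + G y (covDeriv G X y b) (christoffel G y w a)) = 0 := fun w a b ↦ by
    have hd : ∀ a b : V, DifferentiableAt ℝ (fun z ↦ G z (covDeriv G X z a) b) y := fun a b ↦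
      ((hG.differentiableAt hy).clm_apply (hdA a)).clm_apply (differentiableAt_const b)
    have h2 : (fun z ↦ G z (covDeriv G X z a) b + G z (covDeriv G X z b) a) =ᶠ[nhds y]
        fun _ ↦ (0 : ℝ) := by
      filter_upwards [hG.isOpen.mem_nhds hy] with z hz using hX.killing z hz a b
    have h3 := congrArg (fun f : V →L[ℝ] ℝ ↦ f w) h2.fderiv_eq
    simp only [fderiv_fun_add (hd a b) (hd b a), add_apply,
      hG.fderiv_inner hy (hdA _) (differentiableAt_const _),
      covDeriv_const] at h3
    simpa using h3
  -- The relation `h(∇_u W, W) = 0`, differentiated in the direction `u`.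
  have hO : G y (covDeriv G (fun z ↦ covDeriv G X z u) y u) (X y)
      + G y (covDeriv G X y u) (covDeriv G X y u) = 0 := by
    have h2 : (fun z ↦ G z (covDeriv G X z u) (X z)) =ᶠ[nhds y] fun _ ↦ (0 : ℝ) := by
      filter_upwards [hG.isOpen.mem_nhds hy] with z hz using apply_covDeriv_self hG hX hz u
    have h3 := congrArg (fun f : V →L[ℝ] ℝ ↦ f u) h2.fderiv_eq
    simp only [hG.fderiv_inner hy (hdA u)
      ((contDiffAt hG hX hy).differentiableAt (by simp))] at h3
    simpa using h3
  -- `h1` gives `h(∇_W ∇_u W, u)`; `h2` together with `hO` gives `h(∇_u ∇_W W, u)`. The Christoffel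
  -- terms cancel because the connection has no torsion.
  have h1 := hK (X y) u u
  have h2 := hK u (X y) u
  have hs : christoffel G y u (X y) = christoffel G y (X y) u := hG.christoffelBilin_symm hy _ _
  rw [covDeriv_self hG hX hy, hs] at h2
  simp only [map_zero, zero_apply] at h2
  rw [← hG.covDeriv_covDeriv_sub hy (contDiffAt hG hX hy)]
  simp only [map_sub, sub_apply]
  linarith

end IsLocalUnitKilling
end LocalGeometry

/-! ### Linear algebra of definite forms -/

section LinearAlgebra

variable {V : Type*} [AddCommGroup V] [Module ℝ V] [FiniteDimensional ℝ V]

/-- The trace is computed in an orthonormal basis of `B`. -/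
theorem trace_nonneg_of_posDef (B : V →ₗ[ℝ] V →ₗ[ℝ] ℝ) (hsymm : ∀ u v, B u v = B v u)
    (hpos : ∀ u, u ≠ 0 → 0 < B u u) (T : V →ₗ[ℝ] V) (hT : ∀ u, 0 ≤ B (T u) u) :
    0 ≤ LinearMap.trace ℝ V T := by
  let c : InnerProductSpace.Core ℝ V :=
    { inner := fun u v ↦ B u v
      conj_inner_symm := fun u v ↦ by simpa using hsymm v u
      re_inner_nonneg := fun u ↦ by
        by_cases hu : u = 0
        · simp [hu]
        · simpa using (hpos u hu).le
      add_left := fun u v w ↦ by simp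
      smul_left := fun u v r ↦ by simp
      definite := fun u hu ↦ by
        by_contra hne
        exact (hpos u hne).ne' hu }
  let _ : NormedAddCommGroup V := c.toNormedAddCommGroup
  let _ : InnerProductSpace ℝ V := InnerProductSpace.ofCore c.toCore
  rw [LinearMap.trace_eq_sum_inner T (stdOrthonormalBasis ℝ V)]
  refine Finset.sum_nonneg fun i _ ↦ ?_
  rw [real_inner_comm]
  exact hT _

/-- A skew-adjoint endomorphism of an odd-dimensional Euclidean space is singular: its matrix
satisfies `det M = det Mᵀ = det (-M) = -det M`. -/
theorem exists_ne_zero_apply_eq_zero_of_skew (B : V →ₗ[ℝ] V →ₗ[ℝ] ℝ)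
    (hpos : ∀ u, u ≠ 0 → 0 < B u u) (T : V →ₗ[ℝ] V) (hT : ∀ u v, B (T u) v = -B (T v) u)
    (hodd : Odd (Module.finrank ℝ V)) : ∃ u, u ≠ 0 ∧ T u = 0 := by
  let b := Module.finBasis ℝ V
  let A : Matrix (Fin (Module.finrank ℝ V)) (Fin (Module.finrank ℝ V)) ℝ :=
    Matrix.of fun i j ↦ B (T (b i)) (b j)
  have hA : A.transpose = -A := by
    ext i j
    simpa [A] using hT (b j) (b i)
  have hdet : A.det = 0 := by
    have h1 := congrArg Matrix.det hA
    rw [Matrix.det_transpose, Matrix.det_neg, Fintype.card_fin, hodd.neg_one_pow] at h1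
    linarith
  obtain ⟨v, hv, hAv⟩ := Matrix.exists_mulVec_eq_zero_iff.2 hdet
  refine ⟨∑ j, v j • b j, fun h ↦ hv ?_, ?_⟩
  · ext j
    exact Fintype.linearIndependent_iff.1 b.linearIndependent v h j
  · have h1 : ∀ i, B (T (b i)) (∑ j, v j • b j) = 0 := fun i ↦ by
      have := congrFun hAv i
      simpa [A, Matrix.mulVec, dotProduct, mul_comm] using this
    have h2 : B.flip (∑ j, v j • b j) ∘ₗ T = 0 := b.ext h1
    have h3 : ∀ w, B (T (∑ j, v j • b j)) w = 0 := fun w ↦ by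
      rw [hT, neg_eq_zero]
      exact LinearMap.congr_fun h2 w
    by_contra hne
    exact (hpos _ hne).ne' (h3 _)

end LinearAlgebra

/-! ### Curvature of a metric with a unit Killing field -/

section CurvatureSign

variable {V : Type*} [NormedAddCommGroup V] [NormedSpace ℝ V] [FiniteDimensional ℝ V]
  {G : V → V →L[ℝ] V →L[ℝ] ℝ} {X : V → V} {U : Set V} {y : V}

/-- The map `u ↦ R(u, v) w` whose trace is the Ricci tensor. That it is linear depends on the
differentiability of the Christoffel symbols at `y`, hence on `hG` and `hy`. -/
noncomputable def IsLocalMetric.ricciEndomorphism (hG : IsLocalMetric G U)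
    (hy : y ∈ U) (v w : V) : V →ₗ[ℝ] V where
  toFun u := curvature G y u v w
  map_add' u u' := by
    simp only [hG.curvature_eq hy, map_add, add_apply]
    abel
  map_smul' a u := by
    simp only [hG.curvature_eq hy, map_smul, smul_apply, smul_sub, smul_add, RingHom.id_apply]

namespace IsLocalUnitKilling

theorem apply_curvature_nonneg (hG : IsLocalMetric G U) (hX : IsLocalUnitKilling G X U)
    (hy : y ∈ U) (u : V) : 0 ≤ G y (curvature G y u (X y) (X y)) u := by
  rw [apply_curvature hG hX hy]
  exact hG.nonneg hy _

/-- In even dimension, `∇W` acts skew-adjointly on the odd-dimensional orthogonal complement of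
`W`, so some plane containing `W` is flat. -/
theorem exists_apply_curvature_eq_zero (hG : IsLocalMetric G U) (hX : IsLocalUnitKilling G X U)
    (hy : y ∈ U) (heven : Even (Module.finrank ℝ V)) :
    ∃ u, LinearIndependent ℝ ![u, X y] ∧ G y (curvature G y u (X y) (X y)) u = 0 := by
  let f : V →ₗ[ℝ] ℝ := (G y (X y)).toLinearMap
  have hf : f ≠ 0 := fun h ↦ by
    have h1 : f (X y) = 1 := hX.unit y hy
    simp [h] at h1
  have hodd : Odd (Module.finrank ℝ (LinearMap.ker f)) := by
    have h1 := Module.Dual.finrank_ker_add_one_of_ne_zero (K := ℝ) (f := f) hf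
    rw [← h1] at heven
    exact Nat.not_even_iff_odd.1 (Nat.even_add_one.1 heven)
  let B : V →ₗ[ℝ] V →ₗ[ℝ] ℝ := LinearMap.mk₂ ℝ (fun u v ↦ G y u v) (by simp) (by simp) (by simp)
    (by simp)
  let T : LinearMap.ker f →ₗ[ℝ] LinearMap.ker f := (covDerivLinear G X y).restrict fun u _ ↦ by
    rw [LinearMap.mem_ker]
    exact (hG.symm y hy _ _).trans (apply_covDeriv_self hG hX hy u)
  obtain ⟨u, hu, hTu⟩ := exists_ne_zero_apply_eq_zero_of_skew
    (B.domRestrict₁₂ (LinearMap.ker f) (LinearMap.ker f))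
    (fun u hu ↦ hG.pos y hy u (by simpa using hu)) T
    (fun u v ↦ eq_neg_of_add_eq_zero_left (hX.killing y hy u v)) hodd
  have hAu : covDeriv G X y u = 0 := congrArg Subtype.val hTu
  refine ⟨u, ?_, ?_⟩
  · rw [LinearIndependent.pair_iff]
    intro s t hst
    have hu' : G y (X y) u = 0 := u.2
    have ht : t = 0 := by
      have h1 := congrArg (G y (X y)) hst
      simpa [hu', hX.unit y hy] using h1
    refine ⟨?_, ht⟩
    rw [ht, zero_smul, add_zero] at hst
    exact (smul_eq_zero.1 hst).resolve_right (by simpa using hu)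
  · rw [apply_curvature hG hX hy, hAu, map_zero]

/-- In dimension two every plane contains `W`. Writing `W = a u + b v`, the symmetries of the curvature
give `h(R(u, W) W, u) = b² h(R(u, v) v, u)` and `h(R(v, W) W, v) = a² h(R(u, v) v, u)`, and the
left-hand sides are nonnegative. -/
theorem apply_curvature_nonneg_of_finrank_eq_two (hG : IsLocalMetric G U)
    (hX : IsLocalUnitKilling G X U) (hy : y ∈ U) (h2 : Module.finrank ℝ V = 2) {u v : V}
    (huv : LinearIndependent ℝ ![u, v]) : 0 ≤ G y (curvature G y u v v) u := by
  obtain ⟨a, b, hab⟩ : ∃ a b : ℝ, a • u + b • v = X y := by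
    have hspan := huv.span_eq_top_of_card_eq_finrank (by simp [h2])
    have hmem : X y ∈ Submodule.span ℝ (Set.range ![u, v]) := hspan ▸ Submodule.mem_top
    rw [Matrix.range_cons, Matrix.range_cons, Matrix.range_empty, Set.union_empty,
      Set.singleton_union] at hmem
    exact Submodule.mem_span_pair.1 hmem
  have hadd : ∀ p q r s t : V, curvature G y p (a • q + b • r) (a • s + b • t) =
      a • a • curvature G y p q s + a • b • curvature G y p q t
        + (b • a • curvature G y p r s + b • b • curvature G y p r t) := fun p q r s t ↦ by
    simp only [hG.curvature_eq hy, map_add, map_smul, add_apply, smul_apply, smul_sub, smul_add]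
    simp only [smul_smul, mul_comm b a]
    abel
  have hskew : ∀ p q r s : V, G y (curvature G y p q r) s = -G y (curvature G y p q s) r :=
    fun p q r s ↦ by
      have h1 := hG.curvature_apply_self hy p q (r + s)
      have h3 : curvature G y p q (r + s) = curvature G y p q r + curvature G y p q s := by
        simp only [hG.curvature_eq hy, map_add]
        abel
      rw [h3] at h1
      simp only [map_add, add_apply, hG.curvature_apply_self hy] at h1
      linarith
  have hself : ∀ p q : V, curvature G y p p q = 0 := fun p q ↦ by simp [curvature]
  have hu := apply_curvature_nonneg hG hX hy u
  have hv := apply_curvature_nonneg hG hX hy v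
  rw [← hab, hadd] at hu hv
  simp only [hself, smul_zero, zero_add, add_zero, map_add, map_smul, add_apply, smul_apply,
    smul_eq_mul, hG.curvature_apply_self hy] at hu hv
  have hvu : G y (curvature G y v u u) v = G y (curvature G y u v v) u := by
    rw [curvature_swap, map_neg, neg_apply, hskew, neg_neg]
  rw [hvu] at hv
  have hne : a ≠ 0 ∨ b ≠ 0 := by
    by_contra! h
    exact hX.ne_zero hy (by simp [← hab, h.1, h.2])
  by_contra! hneg
  rcases hne with h | h
  · nlinarith [mul_neg_of_pos_of_neg (mul_self_pos.2 h) hneg]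
  · nlinarith [mul_neg_of_pos_of_neg (mul_self_pos.2 h) hneg]

/-- `Ric(W, W) = |∇W|² ≥ 0`. -/
theorem trace_ricciEndomorphism_nonneg (hG : IsLocalMetric G U) (hX : IsLocalUnitKilling G X U)
    (hy : y ∈ U) : 0 ≤ LinearMap.trace ℝ V (hG.ricciEndomorphism hy (X y) (X y)) :=
  trace_nonneg_of_posDef
    (LinearMap.mk₂ ℝ (fun u v ↦ G y u v) (by simp) (by simp) (by simp) (by simp))
    (hG.symm y hy) (hG.pos y hy) _ (apply_curvature_nonneg hG hX hy)

end IsLocalUnitKilling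
end CurvatureSign

/-! ### Passage to a chart -/

section Charts

open Set

variable {n : ℕ} {M : Type*} [TopologicalSpace M] [ChartedSpace (EuclideanSpace ℝ (Fin n)) M]

theorem symm_mem_source (x₀ : M) {y : EuclideanSpace ℝ (Fin n)}
    (hy : y ∈ (extChartAt (𝓡 n) x₀).target) :
    (extChartAt (𝓡 n) x₀).symm y ∈ (chartAt (EuclideanSpace ℝ (Fin n)) x₀).source := by
  rw [← extChartAt_source (𝓡 n)]
  exact (extChartAt (𝓡 n) x₀).map_target hy

theorem coordField_self (W : ∀ x : M, TangentSpace (𝓡 n) x) (x : M) :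
    coordField W x (extChartAt (𝓡 n) x x) = toCoord x x (W x) := by
  have key : ∀ x', (extChartAt (𝓡 n) x).symm (extChartAt (𝓡 n) x x) = x' →
      coordField W x (extChartAt (𝓡 n) x x) = toCoord x x' (W x') := by
    rintro _ rfl
    rfl
  exact key x (extChartAt_to_inv x)

variable [IsManifold (𝓡 n) ∞ M]

theorem ofCoord_toCoord (x₀ : M) {y : EuclideanSpace ℝ (Fin n)}
    (hy : y ∈ (extChartAt (𝓡 n) x₀).target)
    (v : TangentSpace (𝓡 n) ((extChartAt (𝓡 n) x₀).symm y)) :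
    ofCoord x₀ y (toCoord x₀ ((extChartAt (𝓡 n) x₀).symm y) v) = v := by
  have : IsManifold (𝓡 n) 1 M := IsManifold.of_le (n := ∞) (by simp)
  have h := mfderivWithin_extChartAt_symm_comp_mfderiv_extChartAt hy
  rw [ModelWithCorners.range_eq_univ, mfderivWithin_univ] at h
  exact congrArg (fun f ↦ f v) h

theorem toCoord_ofCoord (x₀ : M) {y : EuclideanSpace ℝ (Fin n)}
    (hy : y ∈ (extChartAt (𝓡 n) x₀).target) (v : EuclideanSpace ℝ (Fin n)) :
    toCoord x₀ ((extChartAt (𝓡 n) x₀).symm y) (ofCoord x₀ y v) = v := by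
  have : IsManifold (𝓡 n) 1 M := IsManifold.of_le (n := ∞) (by simp)
  have h := mfderiv_extChartAt_comp_mfderivWithin_extChartAt_symm hy
  rw [ModelWithCorners.range_eq_univ, mfderivWithin_univ] at h
  exact congrArg (fun f ↦ f v) h

/-- A map on a chart target is smooth if it is the coordinate expression of a smooth map. -/
theorem contDiffOn_of_contMDiffAt {F : Type*} [NormedAddCommGroup F] [NormedSpace ℝ F] (x₀ : M)
    {φ : M → F} {ψ : EuclideanSpace ℝ (Fin n) → F}
    (hφ : ∀ x ∈ (chartAt (EuclideanSpace ℝ (Fin n)) x₀).source, ContMDiffAt (𝓡 n) 𝓘(ℝ, F) ∞ φ x)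
    (h : ∀ y ∈ (extChartAt (𝓡 n) x₀).target, ψ y = φ ((extChartAt (𝓡 n) x₀).symm y)) :
    ContDiffOn ℝ ∞ ψ (extChartAt (𝓡 n) x₀).target := by
  rw [← contMDiffOn_iff_contDiffOn]
  refine ContMDiffOn.congr (f := φ ∘ (extChartAt (𝓡 n) x₀).symm) ?_ h
  refine ContMDiffOn.comp (t := (chartAt (EuclideanSpace ℝ (Fin n)) x₀).source)
    (fun x hx ↦ (hφ x hx).contMDiffWithinAt) (contMDiffOn_extChartAt_symm x₀)
    fun y hy ↦ symm_mem_source x₀ hy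

/-- The coordinate expression of `h` is its expression in the trivialization of the bundle of
bilinear forms induced by the chart, hence smooth. -/
theorem contDiffOn_coordMetric (h : RiemMetric n M) (x₀ : M) :
    ContDiffOn ℝ ∞ (coordMetric h x₀) (extChartAt (𝓡 n) x₀).target := by
  have : IsManifold (𝓡 n) 1 M := IsManifold.of_le (n := ∞) (by simp)
  let e := trivializationAt (EuclideanSpace ℝ (Fin n) →L[ℝ] EuclideanSpace ℝ (Fin n) →L[ℝ] ℝ)
    (fun x : M ↦ TangentSpace (𝓡 n) x →L[ℝ] TangentSpace (𝓡 n) x →L[ℝ] ℝ) x₀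
  refine contDiffOn_of_contMDiffAt x₀ (φ := fun x ↦ (e ⟨x, h.inner x⟩).2) (fun x hx ↦ ?_) ?_
  · refine (Bundle.Trivialization.contMDiffAt_section_iff e ?_).1 (h.contMDiff x)
    simpa [e] using hx
  · intro y hy
    have hx := symm_mem_source x₀ hy
    have hL := TangentBundle.symmL_trivializationAt (I := 𝓡 n) hx
    rw [ModelWithCorners.range_eq_univ, mfderivWithin_univ,
      (extChartAt (𝓡 n) x₀).right_inv hy] at hL
    ext u v
    change _ = ContinuousLinearMap.inCoordinates (EuclideanSpace ℝ (Fin n))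
      (fun x : M ↦ TangentSpace (𝓡 n) x) (EuclideanSpace ℝ (Fin n) →L[ℝ] ℝ)
      (fun x : M ↦ TangentSpace (𝓡 n) x →L[ℝ] ℝ) x₀ ((extChartAt (𝓡 n) x₀).symm y) x₀
      ((extChartAt (𝓡 n) x₀).symm y) (h.inner ((extChartAt (𝓡 n) x₀).symm y)) u v
    have hx' : (extChartAt (𝓡 n) x₀).symm y ∈ (trivializationAt (EuclideanSpace ℝ (Fin n))
      (fun x : M ↦ TangentSpace (𝓡 n) x) x₀).baseSet := by simpa using hx
    have hs : ∀ w, (trivializationAt (EuclideanSpace ℝ (Fin n))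
        (fun x : M ↦ TangentSpace (𝓡 n) x) x₀).symm ((extChartAt (𝓡 n) x₀).symm y) w =
        ofCoord x₀ y w := fun w ↦ by
      rw [ofCoord, ← hL, Bundle.Trivialization.symmL_apply _ hx']
    rw [coordMetric_apply, inCoordinates_apply_eq₂ (E₃ := fun _ : M ↦ ℝ) hx' hx' (by simp), hs, hs]
    simp

theorem contDiffOn_coordField {W : ∀ x : M, TangentSpace (𝓡 n) x}
    (hW : ContMDiff (𝓡 n) (𝓡 n).tangent ∞ (fun x ↦ (⟨x, W x⟩ : TangentBundle (𝓡 n) M))) (x₀ : M) :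
    ContDiffOn ℝ ∞ (coordField W x₀) (extChartAt (𝓡 n) x₀).target := by
  have : IsManifold (𝓡 n) 1 M := IsManifold.of_le (n := ∞) (by simp)
  let e := trivializationAt (EuclideanSpace ℝ (Fin n)) (fun x : M ↦ TangentSpace (𝓡 n) x) x₀
  refine contDiffOn_of_contMDiffAt x₀ (φ := fun x ↦ (e ⟨x, W x⟩).2) (fun x hx ↦ ?_) ?_
  · refine (Bundle.Trivialization.contMDiffAt_section_iff e ?_).1 (hW x)
    simpa [e] using hx
  · intro y hy
    have hx := symm_mem_source x₀ hy
    have hL := TangentBundle.continuousLinearMapAt_trivializationAt (I := 𝓡 n) hx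
    rw [coordField, toCoord, ← hL]
    have hx' : (extChartAt (𝓡 n) x₀).symm y ∈ e.baseSet := by simpa [e] using hx
    exact Bundle.Trivialization.continuousLinearMapAt_apply_of_mem (R := ℝ) e hx' _

theorem isLocalMetric_coordMetric (h : RiemMetric n M) (x₀ : M) :
    IsLocalMetric (coordMetric h x₀) (extChartAt (𝓡 n) x₀).target where
  isOpen := isOpen_extChartAt_target x₀
  smooth := contDiffOn_coordMetric h x₀
  symm y _ u v := by
    rw [coordMetric_apply, coordMetric_apply, h.symm]
  pos y hy u hu := by
    rw [coordMetric_apply]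
    refine h.pos _ _ fun h0 ↦ hu ?_
    rw [← toCoord_ofCoord x₀ hy u, h0, map_zero]

theorem IsUnitKilling.isLocalUnitKilling {h : RiemMetric n M}
    {W : ∀ x : M, TangentSpace (𝓡 n) x} (hW : IsUnitKilling h W) (x₀ : M) :
    IsLocalUnitKilling (coordMetric h x₀) (coordField W x₀) (extChartAt (𝓡 n) x₀).target where
  smooth := contDiffOn_coordField hW.smooth x₀
  killing := hW.killing x₀
  unit y hy := by
    rw [coordMetric_apply, coordField, ofCoord_toCoord x₀ hy]
    exact hW.unit _

/-- At the centre of the chart, the coordinate metric is `h` itself. The point is generalized in the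
proof because `(extChartAt x).symm (extChartAt x x)` is only propositionally equal to `x`. -/
theorem coordMetric_toCoord (h : RiemMetric n M) (x : M) (u v : TangentSpace (𝓡 n) x) :
    coordMetric h x (extChartAt (𝓡 n) x x) (toCoord x x u) (toCoord x x v) = h.inner x u v := by
  have key : ∀ x', (extChartAt (𝓡 n) x).symm (extChartAt (𝓡 n) x x) = x' →
      ∀ u v : TangentSpace (𝓡 n) x', coordMetric h x (extChartAt (𝓡 n) x x) (toCoord x x' u)
        (toCoord x x' v) = h.inner x' u v := by
    rintro _ rfl u v
    rw [coordMetric_apply, ofCoord_toCoord x (mem_extChartAt_target x),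
      ofCoord_toCoord x (mem_extChartAt_target x)]
  exact key x (extChartAt_to_inv x) u v

theorem toCoord_isInvertible (x : M) : (toCoord (n := n) x x).IsInvertible := by
  have : IsManifold (𝓡 n) 1 M := IsManifold.of_le (n := ∞) (by simp)
  exact isInvertible_mfderiv_extChartAt (mem_extChartAt_source x)

theorem linearIndependent_toCoord {x : M} {u v : TangentSpace (𝓡 n) x} :
    LinearIndependent ℝ ![toCoord x x u, toCoord x x v] ↔ LinearIndependent ℝ ![u, v] := by
  have hinj := (toCoord_isInvertible (n := n) x).injective
  simp only [LinearIndependent.pair_iff, ← map_smul, ← map_add, map_eq_zero_iff _ hinj]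

end Charts

/-! ### Nonexistence of unit Killing fields -/

section Nonexistence

variable {n : ℕ} {M : Type*} [TopologicalSpace M] [ChartedSpace (EuclideanSpace ℝ (Fin n)) M]
  [IsManifold (𝓡 n) ∞ M] {h : RiemMetric n M} {W : ∀ x : M, TangentSpace (𝓡 n) x}

theorem sectionalCurvature_denominator_nonneg (h : RiemMetric n M) (x : M)
    (u v : TangentSpace (𝓡 n) x) : 0 ≤ h.inner x u u * h.inner x v v - h.inner x u v ^ 2 := by
  simp only [← coordMetric_toCoord h x]
  exact (isLocalMetric_coordMetric h x).cauchy_schwarz (mem_extChartAt_target x) _ _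

namespace IsUnitKilling

theorem ne_zero (hW : IsUnitKilling h W) (x : M) : W x ≠ 0 := fun h0 ↦ by
  simpa [h0] using hW.unit x

/-- Planes containing a unit Killing field have nonnegative curvature. -/
theorem sectionalCurvature_nonneg (hW : IsUnitKilling h W) (x : M) (u : TangentSpace (𝓡 n) x) :
    0 ≤ sectionalCurvature h x u (W x) := by
  refine div_nonneg ?_ (sectionalCurvature_denominator_nonneg h x _ _)
  rw [coordCurvature, ← coordField_self W x]
  exact IsLocalUnitKilling.apply_curvature_nonneg (isLocalMetric_coordMetric h x)
    (hW.isLocalUnitKilling x) (mem_extChartAt_target x) _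

theorem exists_sectionalCurvature_eq_zero (hW : IsUnitKilling h W) (hn : Even n) (x : M) :
    ∃ u : TangentSpace (𝓡 n) x, LinearIndependent ℝ ![u, W x] ∧
      sectionalCurvature h x u (W x) = 0 := by
  obtain ⟨u', hu', h0⟩ := IsLocalUnitKilling.exists_apply_curvature_eq_zero
    (isLocalMetric_coordMetric h x) (hW.isLocalUnitKilling x) (mem_extChartAt_target x)
    (by simpa using hn)
  obtain ⟨u, rfl⟩ := (toCoord_isInvertible x).surjective u'
  rw [coordField_self] at hu' h0
  refine ⟨u, linearIndependent_toCoord.1 hu', ?_⟩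
  rw [sectionalCurvature, coordCurvature, h0, zero_div]

theorem sectionalCurvature_nonneg_of_dim_two (hW : IsUnitKilling h W) (hn : n = 2) (x : M)
    {u v : TangentSpace (𝓡 n) x} (huv : LinearIndependent ℝ ![u, v]) :
    0 ≤ sectionalCurvature h x u v :=
  div_nonneg (IsLocalUnitKilling.apply_curvature_nonneg_of_finrank_eq_two
    (isLocalMetric_coordMetric h x) (hW.isLocalUnitKilling x) (mem_extChartAt_target x)
    (by simpa using hn) (linearIndependent_toCoord.2 huv))
    (sectionalCurvature_denominator_nonneg h x _ _)

theorem ricci_nonneg (hW : IsUnitKilling h W) (x : M) : 0 ≤ ricci h x (W x) (W x) := by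
  have h1 := IsLocalUnitKilling.trace_ricciEndomorphism_nonneg (isLocalMetric_coordMetric h x)
    (hW.isLocalUnitKilling x) (mem_extChartAt_target x)
  rw [LinearMap.trace_eq_sum_inner _ (EuclideanSpace.basisFun (Fin n) ℝ), coordField_self] at h1
  simpa [ricci, IsLocalMetric.ricciEndomorphism, EuclideanSpace.inner_single_left] using h1

theorem exists_linearIndependent (hW : IsUnitKilling h W) (hn : 2 ≤ n) (x : M) :
    ∃ u : TangentSpace (𝓡 n) x, LinearIndependent ℝ ![u, W x] := by
  have hdim : 1 < Module.finrank ℝ (TangentSpace (𝓡 n) x) := by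
    change 1 < Module.finrank ℝ (EuclideanSpace ℝ (Fin n))
    rw [finrank_euclideanSpace_fin]
    exact hn
  obtain ⟨u, hu⟩ := exists_linearIndependent_pair_of_one_lt_finrank hdim (hW.ne_zero x)
  exact ⟨u, LinearIndependent.pair_symm_iff.1 hu⟩

end IsUnitKilling
end Nonexistence
end Kropina

theorem theorem4p18 {n : ℕ} (hn : 2 ≤ n)
    {M : Type*} [TopologicalSpace M] [T2Space M] [SecondCountableTopology M] [Nonempty M]
    [ChartedSpace (EuclideanSpace ℝ (Fin n)) M] [IsManifold (𝓡 n) ∞ M]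
    (h : Kropina.RiemMetric n M)
    (hM : (CompactSpace M ∧ Even n ∧ Kropina.PosSectional h) ∨
      Kropina.NegRicci h ∨
      (n = 2 ∧ Kropina.NegSectionalSomewhere h) ∨
      (3 ≤ n ∧ ∃ c : ℝ, c < 0 ∧ Kropina.ConstSectional h c)) :
    (¬ ∃ W : ∀ x : M, TangentSpace (𝓡 n) x, Kropina.IsUnitKilling h W) ∧
      ¬ ∃ (A : Set (TangentBundle (𝓡 n) M)) (F : A → ℝ), Kropina.IsUKKropina h A F := by
  have main : ¬ ∃ W : ∀ x : M, TangentSpace (𝓡 n) x, Kropina.IsUnitKilling h W := by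
    rintro ⟨W, hW⟩
    obtain ⟨x⟩ := ‹Nonempty M›
    rcases hM with ⟨-, heven, hpos⟩ | hric | ⟨h2, x', u, v, huv, hneg⟩ | ⟨-, c, hc, hconst⟩
    · obtain ⟨u, hu, h0⟩ := hW.exists_sectionalCurvature_eq_zero heven x
      exact (hpos x u (W x) hu).ne' h0
    · exact (hW.ricci_nonneg x).not_gt (hric x (W x) (hW.ne_zero x))
    · exact (hW.sectionalCurvature_nonneg_of_dim_two h2 x' huv).not_gt hneg
    · obtain ⟨u, hu⟩ := hW.exists_linearIndependent hn x
      exact (hW.sectionalCurvature_nonneg x u).not_gt ((hconst x u (W x) hu).trans_lt hc)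
  exact ⟨main, fun ⟨_, _, W, _, hW, _⟩ ↦ main ⟨W, hW⟩⟩
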